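/- Let $(\cdot,\cdot)$ and $\|\cdot\|$ be the Euclidean inner product and norm of $\mathbb R^n$, let $B_R(c)$ be the closed ball of radius $R$ centred at $c$, and let $h$ be the Hausdorff distance. Let $\varepsilon\in(0,1)$, $r>0$, $d>0$, and put $R=\max\{r^2/\varepsilon,\;r+1\}$. For a metric space $(T,\varrho)$ call a set-valued map $F:T\to 2^{\mathbb R^n}\setminus\{\emptyset\}$ *$(r,d)$-admissible* if it is continuous (i.e. for every $t_0\in T$ and $\eta>0$ there is $\delta>0$ such that $\varrho(t,t_0)<\delta$ implies $F(t)\subset F(t_0)+B_\eta(0)$ and $F(t_0)\subset F(t)+B_\eta(0)$), its images are compact and convex, for every $t\in T$ there is $a(t)\in\mathbb R^n$ with $F(t)\subset B_r(a(t))$, and $\operatorname{diam}F(t)\ge d$ for all $t\in T$. For such $F$ let $F_\varepsilon(t)$ be the $R$-strongly convex hull of $F(t)$, that is, the intersection of all closed balls of radius $R$ that contain $F(t)$. (i) There is a constant $C$ depending only on $\varepsilon,r,d$ such that for every $n$, every metric space $T$ and every $(r,d)$-admissible $F:T\to2^{\mathbb R^n}\setminus\{\emptyset\}$ the following holds. For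 all $t\in T$ the set $F_\varepsilon(t)$ is compact and convex, $F(t)\subset F_\varepsilon(t)$ and $h(F(t),F_\varepsilon(t))\le\varepsilon$. For all $t\in T$ and all $p\in\mathbb R^n$ with $\|p\|=1$ the problem $\max\{(p,x)\mid x\in F_\varepsilon(t)\}$ has a unique solution $f_\varepsilon(t,p)$, and for all $t_1,t_2\in T$ and $\|p\|=1$ $$\|f_\varepsilon(t_1,p)-f_\varepsilon(t_2,p)\|\le C\max\Big\{\sqrt{h(F(t_1),F(t_2))},\;h(F(t_1),F(t_2))\Big\}.$$ Thus $f_\varepsilon(\cdot,p)$ is Hölder continuous with power $\tfrac12$ with respect to $h(F(t_1),F(t_2))$, with constant $C$ as long as $h(F(t_1),F(t_2))\le1$, and with constant $C\max\{1,\sqrt M\}$ as long as $h(F(t_1),F(t_2))\le M$. (ii) The power $\tfrac12$ is the best possible for this approximation: if $n\ge2$ and $d<2r$, there are a metric space $T$ and an $(r,d)$-admissible map $F:T\to2^{\mathbb R^n}\setminus\{\emptyset\}$ such that for every $\alpha>\tfrac12$, every $C\in\mathbb R$ and every $\delta>0$ there are $t_1,t_2\in T$ and $p\in\mathbb R^n$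 with $\|p\|=1$ for which $h(F(t_1),F(t_2))<\delta$ and $$\|f_\varepsilon(t_1,p)-f_\varepsilon(t_2,p)\|>C\,h(F(t_1),F(t_2))^{\alpha}.$$ -/

import Mathlib

open scoped Pointwise

/-- Upper semicontinuity of a set-valued map at `t₀`, in the `ε`-`δ` sense. -/
def UpperSemicontAt {T E : Type*} [MetricSpace T] [NormedAddCommGroup E]
    (F : T → Set E) (t₀ : T) : Prop :=
  ∀ η : ℝ, 0 < η → ∃ δ : ℝ, 0 < δ ∧ ∀ t : T, dist t t₀ < δ →
    F t ⊆ F t₀ + Metric.closedBall (0 : E) η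

/-- Lower semicontinuity of a set-valued map at `t₀`, in the `ε`-`δ` sense. -/
def LowerSemicontAt {T E : Type*} [MetricSpace T] [NormedAddCommGroup E]
    (F : T → Set E) (t₀ : T) : Prop :=
  ∀ η : ℝ, 0 < η → ∃ δ : ℝ, 0 < δ ∧ ∀ t : T, dist t t₀ < δ →
    F t₀ ⊆ F t + Metric.closedBall (0 : E) η

/-- A set-valued map is continuous if it is upper and lower semicontinuous at every point. -/
def SetValuedContinuous {T E : Type*} [MetricSpace T] [NormedAddCommGroup E]
    (F : T → Set E) : Prop :=
  ∀ t₀ : T, UpperSemicontAt F t₀ ∧ LowerSemicontAt F t₀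

/-- Continuous set-valued maps with nonempty convex compact images, each contained in some closed
ball of radius `r` and each of diameter at least `d`. -/
structure IsAdmissible {n : ℕ} {T : Type*} [MetricSpace T] (r d : ℝ)
    (F : T → Set (EuclideanSpace ℝ (Fin n))) : Prop where
  continuous : SetValuedContinuous F
  nonempty : ∀ t, (F t).Nonempty
  compact : ∀ t, IsCompact (F t)
  convex : ∀ t, Convex ℝ (F t)
  subset_ball : ∀ t, ∃ a, F t ⊆ Metric.closedBall a r
  le_diam : ∀ t, d ≤ Metric.diam (F t)

/-- The solution set of the problem `max {(p, x) | x ∈ A}`. -/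
def argmaxSet {n : ℕ} (p : EuclideanSpace ℝ (Fin n)) (A : Set (EuclideanSpace ℝ (Fin n))) :
    Set (EuclideanSpace ℝ (Fin n)) :=
  {x | x ∈ A ∧ ∀ y ∈ A, inner ℝ p y ≤ inner ℝ p x}

/-- The `R`-strongly convex hull of `A`: the intersection of all closed balls of radius `R`
that contain `A`. -/
def stronglyConvexHull {n : ℕ} (R : ℝ) (A : Set (EuclideanSpace ℝ (Fin n))) :
    Set (EuclideanSpace ℝ (Fin n)) :=
  {x | ∀ c, A ⊆ Metric.closedBall c R → x ∈ Metric.closedBall c R}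

/-- The approximation `F_ε` of a map `F` whose images lie in balls of radius `r`: the strongly
convex hull of each image, with radius `max (r ^ 2 / ε) (r + 1)`. -/
noncomputable def strongApprox {n : ℕ} {T : Type*} (ε r : ℝ)
    (F : T → Set (EuclideanSpace ℝ (Fin n))) : T → Set (EuclideanSpace ℝ (Fin n)) :=
  fun t => stronglyConvexHull (max (r ^ 2 / ε) (r + 1)) (F t)

/-! A half-space cuts `B_r(a)` in a set that fits in an `R`-ball protruding by at most `ε`, because
`r² ≤ Rε`. Separating a hull point from `F t` then bounds the error
(`infDist_le_of_mem_stronglyConvexHull`).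

The hull lies in the `R`-ball touching it at any support point
(`stronglyConvexHull_subset_closedBall`), so support points are unique. If two images are at
distance `h`, each hull lies in the other's supporting balls enlarged by `O(h)`
(`mem_closedBall_of_mem_stronglyConvexHull`), which forces `‖x - y‖² = O(h + h²)` for support points
in a common direction (`norm_sub_sq_le_of_mem_closedBall`).

For sharpness, take the hull of a ball of radius `ρ = d/2` and a point at height `s`. As `s` leaves
`ρ`, the set moves by at most `s - ρ`, but some support point moves by order `√(s - ρ)`
(`exists_argmaxSet_ballCap`). -/

open Metric

/-! ### Geometry of the strongly convex hull -/

section StronglyConvexHull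

variable {n : ℕ} {R : ℝ} {A : Set (EuclideanSpace ℝ (Fin n))}

theorem subset_stronglyConvexHull : A ⊆ stronglyConvexHull R A :=
  fun _ hx _ hc => hc hx

theorem stronglyConvexHull_eq_iInter :
    stronglyConvexHull R A = ⋂ (c) (_ : A ⊆ closedBall c R), closedBall c R := by
  ext x
  simp [stronglyConvexHull]

theorem convex_stronglyConvexHull : Convex ℝ (stronglyConvexHull R A) := by
  rw [stronglyConvexHull_eq_iInter]
  exact convex_iInter₂ fun c _ => convex_closedBall c R

theorem isCompact_stronglyConvexHull {a : EuclideanSpace ℝ (Fin n)} (ha : A ⊆ closedBall a R) :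
    IsCompact (stronglyConvexHull R A) := by
  refine (isCompact_closedBall a R).of_isClosed_subset ?_ fun x hx => hx a ha
  rw [stronglyConvexHull_eq_iInter]
  exact isClosed_iInter fun c => isClosed_iInter fun _ => isClosed_closedBall

/-- The part of a closed ball of radius `r` cut off by a half-space lies in a ball of radius `R`
that exceeds the half-space by at most `ε`. -/
theorem mem_closedBall_of_inner_le {a p z : EuclideanSpace ℝ (Fin n)} {r ε s : ℝ} (hε₀ : 0 < ε)
    (hεR : ε ≤ R) (hrR : r ^ 2 ≤ R * ε) (hp : ‖p‖ = 1) (hs : s + ε ≤ R)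
    (hz : z ∈ closedBall a r) (hzs : inner ℝ p (z - a) ≤ s) :
    z ∈ closedBall (a + (s + ε - R) • p) R := by
  rw [mem_closedBall, dist_eq_norm] at hz ⊢
  have hR : 0 < R := hε₀.trans_le hεR
  refine abs_le_of_sq_le_sq' ?_ hR.le |>.2
  have h1 : ‖z - (a + (s + ε - R) • p)‖ ^ 2
      = ‖z - a‖ ^ 2 - 2 * (s + ε - R) * inner ℝ p (z - a) + (s + ε - R) ^ 2 := by
    rw [← sub_sub, norm_sub_sq_real, inner_smul_right, norm_smul, hp, real_inner_comm,
      Real.norm_eq_abs, mul_one, sq_abs]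
    ring
  have h2 : ‖z - a‖ ^ 2 ≤ r ^ 2 := pow_le_pow_left₀ (norm_nonneg _) hz 2
  have h3 := mul_le_mul_of_nonneg_left hzs (by linarith : 0 ≤ 2 * (R - (s + ε)))
  have h4 := mul_le_mul_of_nonneg_right hεR hε₀.le
  -- The bounds add up to `r² + (R - ε)² - s²`; in `-2Rε`, one `Rε` absorbs `r²` and the other
  -- absorbs `ε²`.
  nlinarith [sq_nonneg s]

/-- Project `x` to `y ∈ A`. Were `‖x - y‖ > ε`, the `R`-ball protruding by `ε` beyond the supporting
half-space at `y` would contain `A` but not `x`. -/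
theorem infDist_le_of_mem_stronglyConvexHull {a x : EuclideanSpace ℝ (Fin n)} {r ε : ℝ}
    (hε₀ : 0 < ε) (hε₁ : ε ≤ 1) (hr : 0 < r) (hR : r + 1 ≤ R) (hrR : r ^ 2 ≤ R * ε)
    (hne : A.Nonempty) (hA : IsCompact A) (hconv : Convex ℝ A) (ha : A ⊆ closedBall a r)
    (hx : x ∈ stronglyConvexHull R A) : infDist x A ≤ ε := by
  obtain ⟨y, hy, hmin⟩ := exists_norm_eq_iInf_of_complete_convex hne hA.isComplete hconv x
  rw [norm_eq_iInf_iff_real_inner_le_zero hconv hy] at hmin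
  refine (infDist_le_dist_of_mem hy).trans ?_
  rw [dist_eq_norm]
  by_contra! hlt
  have hpos : 0 < ‖x - y‖ := hε₀.trans hlt
  set p := ‖x - y‖⁻¹ • (x - y) with hp
  have hp1 : ‖p‖ = 1 := by
    rw [hp, norm_smul, norm_inv, norm_norm, inv_mul_cancel₀ hpos.ne']
  have hpy : inner ℝ p (y - a) ≤ r := by
    have h1 := ha hy
    rw [mem_closedBall, dist_eq_norm] at h1
    have h2 := real_inner_le_norm p (y - a)
    rw [hp1, one_mul] at h2
    exact h2.trans h1
  have hsub : A ⊆ closedBall (a + (inner ℝ p (y - a) + ε - R) • p) R := by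
    intro z hz
    refine mem_closedBall_of_inner_le (r := r) hε₀ (by linarith) hrR hp1 (by linarith) (ha hz) ?_
    have h1 : inner ℝ p (z - y) ≤ 0 := by
      rw [hp, real_inner_smul_left]
      exact mul_nonpos_of_nonneg_of_nonpos (by positivity) (hmin z hz)
    have h2 : inner ℝ p (z - a) = inner ℝ p (z - y) + inner ℝ p (y - a) := by
      rw [← inner_add_right, sub_add_sub_cancel]
    linarith
  have hxb := hx _ hsub
  rw [mem_closedBall, dist_eq_norm] at hxb
  have h1 := real_inner_le_norm p (x - (a + (inner ℝ p (y - a) + ε - R) • p))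
  rw [hp1, one_mul, ← sub_sub, inner_sub_right, inner_smul_right, real_inner_self_eq_norm_sq,
    hp1] at h1
  have h2 : inner ℝ p (x - a) = ‖x - y‖ + inner ℝ p (y - a) := by
    have h3 : inner ℝ p (x - y) = ‖x - y‖ := by
      rw [hp, real_inner_smul_left, real_inner_self_eq_norm_sq]
      field_simp
    rw [← h3, ← inner_add_right, sub_add_sub_cancel]
  rw [← sub_sub] at hxb
  linarith

theorem hausdorffDist_stronglyConvexHull_le {a : EuclideanSpace ℝ (Fin n)} {r ε : ℝ}
    (hε₀ : 0 < ε) (hε₁ : ε ≤ 1) (hr : 0 < r) (hR : r + 1 ≤ R) (hrR : r ^ 2 ≤ R * ε)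
    (hne : A.Nonempty) (hA : IsCompact A) (hconv : Convex ℝ A) (ha : A ⊆ closedBall a r) :
    hausdorffDist A (stronglyConvexHull R A) ≤ ε := by
  refine hausdorffDist_le_of_infDist hε₀.le (fun x hx => ?_) fun x hx =>
    infDist_le_of_mem_stronglyConvexHull hε₀ hε₁ hr hR hrR hne hA hconv ha hx
  rw [infDist_zero_of_mem (subset_stronglyConvexHull hx)]
  exact hε₀.le

/-- The strongly convex hull contains, with two points, a ball of quadratic size around each
convex combination of them. -/
theorem add_smul_mem_stronglyConvexHull {x z p : EuclideanSpace ℝ (Fin n)} {t : ℝ} (hR : 0 < R)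
    (hx : x ∈ stronglyConvexHull R A) (hz : z ∈ stronglyConvexHull R A) (hp : ‖p‖ = 1)
    (ht₀ : 0 ≤ t) (ht₁ : t ≤ 1) :
    x + t • (z - x) + (t * (1 - t) * ‖z - x‖ ^ 2 / (2 * R)) • p ∈ stronglyConvexHull R A := by
  intro c hc
  have hxc := hx c hc
  have hzc := hz c hc
  rw [mem_closedBall, dist_eq_norm] at hxc hzc ⊢
  set q := t * (1 - t) * ‖z - x‖ ^ 2 with hq
  have hq0 : 0 ≤ q := by
    have : 0 ≤ 1 - t := by linarith
    positivity
  have hsq : ‖x - c + t • (z - x)‖ ^ 2 ≤ R ^ 2 - q := by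
    have h1 : ‖x - c + t • (z - x)‖ ^ 2
        = (1 - t) * ‖x - c‖ ^ 2 + t * ‖z - c‖ ^ 2 - q := by
      have e : z - c = (x - c) + (z - x) := by abel
      rw [hq, e, norm_add_sq_real, norm_add_sq_real, inner_smul_right, norm_smul,
        Real.norm_eq_abs, mul_pow, sq_abs]
      ring
    have h2 : ‖x - c‖ ^ 2 ≤ R ^ 2 := pow_le_pow_left₀ (norm_nonneg _) hxc 2
    have h3 : ‖z - c‖ ^ 2 ≤ R ^ 2 := pow_le_pow_left₀ (norm_nonneg _) hzc 2
    nlinarith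
  -- This is `√(R² - q) ≤ R - q / (2R)`.
  have hle : ‖x - c + t • (z - x)‖ ≤ R - q / (2 * R) := by
    have hqR : q ≤ R ^ 2 := by nlinarith [sq_nonneg ‖x - c + t • (z - x)‖]
    have h1 : 0 ≤ R - q / (2 * R) := by
      rw [sub_nonneg, div_le_iff₀ (by positivity)]
      nlinarith
    refine abs_le_of_sq_le_sq' (hsq.trans ?_) h1 |>.2
    have h2 : (R - q / (2 * R)) ^ 2 = R ^ 2 - q + (q / (2 * R)) ^ 2 := by
      field_simp
      ring
    rw [h2]
    nlinarith [sq_nonneg (q / (2 * R))]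
  have hnp : ‖(q / (2 * R)) • p‖ = q / (2 * R) := by
    rw [norm_smul, hp, mul_one, Real.norm_of_nonneg (by positivity)]
  calc ‖x + t • (z - x) + (q / (2 * R)) • p - c‖
      = ‖(x - c + t • (z - x)) + (q / (2 * R)) • p‖ := by congr 1; abel
    _ ≤ ‖x - c + t • (z - x)‖ + ‖(q / (2 * R)) • p‖ := norm_add_le _ _
    _ ≤ R := by rw [hnp]; linarith

/-- The supporting ball property: the strongly convex hull lies in the ball of radius `R` that
touches it at a point of support. -/
theorem stronglyConvexHull_subset_closedBall {x p : EuclideanSpace ℝ (Fin n)} (hR : 0 < R)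
    (hp : ‖p‖ = 1) (hx : x ∈ argmaxSet p (stronglyConvexHull R A)) :
    stronglyConvexHull R A ⊆ closedBall (x - R • p) R := by
  intro z hz
  -- Maximality of `x` is tested against the points of the lens between `x` and `z`, divided by `t`;
  -- then `t → 0`.
  have key : ∀ t : ℝ, 0 < t → t < 1 →
      inner ℝ p (z - x) + (1 - t) * (‖z - x‖ ^ 2 / (2 * R)) ≤ 0 := by
    intro t ht₀ ht₁
    have h1 := hx.2 _ (add_smul_mem_stronglyConvexHull hR hx.1 hz hp ht₀.le ht₁.le)
    rw [inner_add_right, inner_add_right, inner_smul_right, inner_smul_right,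
      real_inner_self_eq_norm_sq, hp] at h1
    have h2 : t * (inner ℝ p (z - x) + (1 - t) * (‖z - x‖ ^ 2 / (2 * R))) ≤ t * 0 := by
      have : t * (1 - t) * ‖z - x‖ ^ 2 / (2 * R) = t * ((1 - t) * (‖z - x‖ ^ 2 / (2 * R))) := by
        ring
      rw [this] at h1
      linarith
    exact le_of_mul_le_mul_left h2 ht₀
  have hlim : inner ℝ p (z - x) + (1 - 0) * (‖z - x‖ ^ 2 / (2 * R)) ≤ 0 := by
    have hcont : Continuous fun t : ℝ => inner ℝ p (z - x) + (1 - t) * (‖z - x‖ ^ 2 / (2 * R)) := by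
      fun_prop
    refine le_of_tendsto (hcont.tendsto 0 |>.mono_left
      (nhdsWithin_le_nhds (s := Set.Ioi (0 : ℝ)))) ?_
    filter_upwards [Ioo_mem_nhdsGT (zero_lt_one' ℝ)] with t ht using key t ht.1 ht.2
  rw [mem_closedBall, dist_eq_norm]
  refine abs_le_of_sq_le_sq' ?_ hR.le |>.2
  have e : z - (x - R • p) = (z - x) + R • p := by abel
  rw [e, norm_add_sq_real, inner_smul_right, norm_smul, hp, real_inner_comm, mul_one,
    Real.norm_eq_abs, sq_abs]
  have h3 : ‖z - x‖ ^ 2 / (2 * R) * (2 * R) = ‖z - x‖ ^ 2 := by field_simp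
  nlinarith

/-- Converse of the supporting ball property; it identifies support points in the example. -/
theorem mem_argmaxSet_stronglyConvexHull {x p : EuclideanSpace ℝ (Fin n)} (hp : ‖p‖ = 1)
    (hx : x ∈ A) (hA : A ⊆ closedBall (x - R • p) R) :
    x ∈ argmaxSet p (stronglyConvexHull R A) := by
  refine ⟨subset_stronglyConvexHull hx, fun y hy => ?_⟩
  have h1 := hy _ hA
  rw [mem_closedBall, dist_eq_norm] at h1
  have h2 := real_inner_le_norm p (y - (x - R • p))
  rw [hp, one_mul] at h2
  replace h2 := h2.trans h1
  rw [inner_sub_right, inner_sub_right, inner_smul_right, real_inner_self_eq_norm_sq, hp] at h2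
  linarith

/-- Two support points in the same direction of sets that lie, up to an error `k`, in each
other's supporting balls. -/
theorem norm_sub_sq_le_of_mem_closedBall {x y p : EuclideanSpace ℝ (Fin n)} {k : ℝ}
    (hp : ‖p‖ = 1) (hx : x ∈ closedBall (y - R • p) (R + k))
    (hy : y ∈ closedBall (x - R • p) (R + k)) :
    ‖x - y‖ ^ 2 ≤ 2 * R * k + k ^ 2 := by
  rw [mem_closedBall, dist_eq_norm] at hx hy
  have h1 := pow_le_pow_left₀ (norm_nonneg _) hx 2
  have h2 := pow_le_pow_left₀ (norm_nonneg _) hy 2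
  have e1 : x - (y - R • p) = (x - y) + R • p := by abel
  have e2 : y - (x - R • p) = R • p - (x - y) := by abel
  rw [e1, norm_add_sq_real, norm_smul, hp, mul_one, Real.norm_eq_abs, sq_abs] at h1
  rw [e2, norm_sub_sq_real, norm_smul, hp, mul_one, Real.norm_eq_abs, sq_abs,
    real_inner_comm] at h2
  -- In the sum of the two expansions the terms `±2R (p, x - y)` cancel.
  linarith

theorem exists_argmaxSet_stronglyConvexHull_eq_singleton {a p : EuclideanSpace ℝ (Fin n)}
    (hR : 0 < R) (hne : A.Nonempty) (ha : A ⊆ closedBall a R) (hp : ‖p‖ = 1) :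
    ∃ x, argmaxSet p (stronglyConvexHull R A) = {x} := by
  obtain ⟨x, hx, hmax⟩ := (isCompact_stronglyConvexHull ha).exists_isMaxOn
    (hne.mono subset_stronglyConvexHull)
    (f := fun y => (inner ℝ p y : ℝ)) (by fun_prop)
  have hx' : x ∈ argmaxSet p (stronglyConvexHull R A) := ⟨hx, fun y hy => hmax hy⟩
  refine ⟨x, Set.eq_singleton_iff_unique_mem.2 ⟨hx', fun y hy => ?_⟩⟩
  have h := norm_sub_sq_le_of_mem_closedBall (R := R) (k := 0) hp
    (by simpa using stronglyConvexHull_subset_closedBall hR hp hx' hy.1)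
    (by simpa using stronglyConvexHull_subset_closedBall hR hp hy hx)
  have h0 : ‖y - x‖ ^ 2 = 0 := le_antisymm (by simpa using h) (sq_nonneg _)
  exact sub_eq_zero.1 (norm_eq_zero.1 (pow_eq_zero_iff two_ne_zero |>.1 h0))

/-- Points of the strongly convex hull of `B` almost lie in every ball of radius `R` containing a
set `A` that is close to `B`. -/
theorem mem_closedBall_of_mem_stronglyConvexHull {B : Set (EuclideanSpace ℝ (Fin n))}
    {a b c x : EuclideanSpace ℝ (Fin n)} {r h : ℝ} (hr : 0 < r) (hR : r + 1 ≤ R) (hh : 0 ≤ h)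
    (hB : B.Nonempty) (ha : A ⊆ closedBall a r) (hb : B ⊆ closedBall b r)
    (hBA : ∀ y ∈ B, ∃ z ∈ A, dist y z ≤ h) (hc : A ⊆ closedBall c R)
    (hx : x ∈ stronglyConvexHull R B) : x ∈ closedBall c (R + (4 * R + 1) * h) := by
  obtain ⟨y, hy⟩ := hB
  obtain ⟨z, hz, hyz⟩ := hBA y hy
  have hza : dist z a ≤ r := ha hz
  have hzc : dist z c ≤ R := hc hz
  have hac : dist a c ≤ 2 * R := by
    linarith [dist_triangle_left a c z]
  rw [mem_closedBall]
  by_cases hle : h ≤ R - r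
  · have hRr : 0 < R - r := by linarith
    -- Since `A` also lies in `B_r(a)`, shifting the centre from `c` towards `a` by the fraction `θ`
    -- shrinks the radius to `R - h`, leaving room for `B`. The gap `R - r ≥ 1` gives `θ ≤ h`.
    set θ := h / (R - r) with hθ
    have hθ0 : 0 ≤ θ := by positivity
    have hθ1 : θ ≤ 1 := (div_le_one hRr).2 hle
    have hθR : θ * (R - r) = h := by rw [hθ]; field_simp
    have hθh : θ ≤ h := by nlinarith
    have hsub : B ⊆ closedBall (c + θ • (a - c)) R := by
      intro w hw
      obtain ⟨v, hv, hwv⟩ := hBA w hw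
      have hva : ‖v - a‖ ≤ r := by rw [← dist_eq_norm]; exact ha hv
      have hvc : ‖v - c‖ ≤ R := by rw [← dist_eq_norm]; exact hc hv
      have hvb : dist v (c + θ • (a - c)) ≤ R - h := by
        rw [dist_eq_norm]
        calc ‖v - (c + θ • (a - c))‖ = ‖(1 - θ) • (v - c) + θ • (v - a)‖ := by
              congr 1; module
          _ ≤ ‖(1 - θ) • (v - c)‖ + ‖θ • (v - a)‖ := norm_add_le _ _
          _ = (1 - θ) * ‖v - c‖ + θ * ‖v - a‖ := by
              rw [norm_smul, norm_smul, Real.norm_of_nonneg hθ0,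
                Real.norm_of_nonneg (by linarith)]
          _ ≤ (1 - θ) * R + θ * r := by gcongr
          _ = R - h := by rw [← hθR]; ring
      rw [mem_closedBall]
      linarith [dist_triangle w v (c + θ • (a - c))]
    have hxc : dist x (c + θ • (a - c)) ≤ R := hx _ hsub
    have hcc : dist (c + θ • (a - c)) c ≤ h * (2 * R) := by
      rw [dist_eq_norm, add_sub_cancel_left, norm_smul, Real.norm_of_nonneg hθ0, ← dist_eq_norm]
      gcongr
    have hRh : 0 ≤ R * h := by
      have : 0 ≤ R := by linarith
      positivity
    linarith [dist_triangle x (c + θ • (a - c)) c]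
  -- For large `h` the triangle inequality through `b`, `y`, `z` is enough.
  · have h1 : 1 ≤ h := by linarith
    have hxb : dist x b ≤ R := hx b (hb.trans (closedBall_subset_closedBall (by linarith)))
    have hyb : dist y b ≤ r := hb hy
    have hRh : R ≤ R * h := le_mul_of_one_le_right (by linarith) h1
    linarith [dist_triangle x b c, dist_triangle_left b c y, dist_triangle y z c]

end StronglyConvexHull

/-! ### Hölder estimate for support points -/

theorem IsCompact.exists_dist_le_hausdorffDist {X : Type*} [PseudoMetricSpace X] {s t : Set X}
    (hs : IsCompact s) (ht : IsCompact t) (hsne : s.Nonempty) (htne : t.Nonempty) :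
    ∀ x ∈ s, ∃ y ∈ t, dist x y ≤ hausdorffDist s t := by
  intro x hx
  obtain ⟨y, hy, hxy⟩ := ht.exists_infDist_eq_dist htne x
  refine ⟨y, hy, hxy ▸ infDist_le_hausdorffDist_of_mem hx ?_⟩
  exact hausdorffEDist_ne_top_of_nonempty_of_bounded hsne htne hs.isBounded ht.isBounded

section HolderBound

variable {n : ℕ} {R r : ℝ} {A B : Set (EuclideanSpace ℝ (Fin n))}
  {a b p x y : EuclideanSpace ℝ (Fin n)}

/-- Support points of strongly convex hulls are Hölder continuous with exponent `1 / 2` with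
respect to the Hausdorff distance. -/
theorem norm_sub_le_of_mem_argmaxSet (hr : 0 < r) (hR : r + 1 ≤ R) (hA : IsCompact A)
    (hB : IsCompact B) (hAne : A.Nonempty) (hBne : B.Nonempty) (ha : A ⊆ closedBall a r)
    (hb : B ⊆ closedBall b r) (hp : ‖p‖ = 1) (hx : x ∈ argmaxSet p (stronglyConvexHull R A))
    (hy : y ∈ argmaxSet p (stronglyConvexHull R B)) :
    ‖x - y‖ ≤ √(2 * R * (4 * R + 1) + (4 * R + 1) ^ 2) *
      max (√(hausdorffDist A B)) (hausdorffDist A B) := by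
  have hR0 : 0 < R := by linarith
  have hh : 0 ≤ hausdorffDist A B := hausdorffDist_nonneg
  have hAB := hA.exists_dist_le_hausdorffDist hB hAne hBne
  have hBA := hB.exists_dist_le_hausdorffDist hA hBne hAne
  rw [hausdorffDist_comm] at hBA
  set h := hausdorffDist A B
  have key := norm_sub_sq_le_of_mem_closedBall (R := R) hp
    (mem_closedBall_of_mem_stronglyConvexHull hr hR hh hAne hb ha hAB
      (subset_stronglyConvexHull.trans (stronglyConvexHull_subset_closedBall hR0 hp hy)) hx.1)
    (mem_closedBall_of_mem_stronglyConvexHull hr hR hh hBne ha hb hBA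
      (subset_stronglyConvexHull.trans (stronglyConvexHull_subset_closedBall hR0 hp hx)) hy.1)
  -- Both `h` and `h²` are at most `m²`.
  set m := max (√h) h
  have hm : 0 ≤ m := le_max_of_le_right hh
  have h1 : h ≤ m ^ 2 := by
    rw [← Real.sq_sqrt hh]
    exact pow_le_pow_left₀ (Real.sqrt_nonneg _) (le_max_left _ _) 2
  have h2 : h ^ 2 ≤ m ^ 2 := pow_le_pow_left₀ hh (le_max_right _ _) 2
  rw [← Real.sqrt_sq hm, ← Real.sqrt_mul (by positivity)]
  refine Real.le_sqrt_of_sq_le (key.trans ?_)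
  calc 2 * R * ((4 * R + 1) * h) + ((4 * R + 1) * h) ^ 2
      = 2 * R * (4 * R + 1) * h + (4 * R + 1) ^ 2 * h ^ 2 := by ring
    _ ≤ 2 * R * (4 * R + 1) * m ^ 2 + (4 * R + 1) ^ 2 * m ^ 2 := by gcongr
    _ = (2 * R * (4 * R + 1) + (4 * R + 1) ^ 2) * m ^ 2 := by ring

end HolderBound

/-! ### The example for sharpness -/

theorem IsCompact.convexHull_insert {E : Type*} [AddCommGroup E] [Module ℝ E] [TopologicalSpace E]
    [ContinuousAdd E] [ContinuousSMul ℝ E] {K : Set E} (hK : IsCompact K) (hconv : Convex ℝ K)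
    (hne : K.Nonempty) (x : E) : IsCompact (convexHull ℝ (insert x K)) := by
  have h : convexHull ℝ (insert x K)
      = (fun q : ℝ × E => (1 - q.1) • x + q.1 • q.2) '' Set.Icc (0 : ℝ) 1 ×ˢ K := by
    rw [_root_.convexHull_insert hne, hconv.convexHull_eq, convexJoin_singleton_left]
    ext z
    simp only [segment_eq_image, Set.mem_iUnion, Set.mem_image, Set.mem_prod, Prod.exists,
      exists_prop]
    constructor
    · rintro ⟨y, hy, θ, hθ, rfl⟩
      exact ⟨θ, y, ⟨hθ, hy⟩, rfl⟩
    · rintro ⟨θ, y, ⟨hθ, hy⟩, rfl⟩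
      exact ⟨y, hy, θ, hθ, rfl⟩
  rw [h]
  exact (isCompact_Icc.prod hK).image (by fun_prop)

section Sharpness

variable {n : ℕ} {ρ : ℝ} {e : EuclideanSpace ℝ (Fin n)}

/-- The convex hull of the ball of radius `ρ` centred at the origin and the point at height `s`
in direction `e`. -/
def ballCap (ρ : ℝ) (e : EuclideanSpace ℝ (Fin n)) (s : ℝ) : Set (EuclideanSpace ℝ (Fin n)) :=
  convexHull ℝ (insert (s • e) (closedBall 0 ρ))

theorem smul_mem_ballCap (s : ℝ) : s • e ∈ ballCap ρ e s :=
  subset_convexHull ℝ _ (Set.mem_insert _ _)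

theorem closedBall_subset_ballCap (s : ℝ) : closedBall 0 ρ ⊆ ballCap ρ e s :=
  (Set.subset_insert _ _).trans (subset_convexHull ℝ _)

theorem isCompact_ballCap (hρ : 0 ≤ ρ) (s : ℝ) : IsCompact (ballCap ρ e s) :=
  (isCompact_closedBall 0 ρ).convexHull_insert (convex_closedBall 0 ρ)
    (nonempty_closedBall.2 hρ) _

theorem ballCap_subset_closedBall {c : EuclideanSpace ℝ (Fin n)} {s t : ℝ}
    (hs : s • e ∈ closedBall c t) (hρ : closedBall 0 ρ ⊆ closedBall c t) :
    ballCap ρ e s ⊆ closedBall c t :=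
  convexHull_min (Set.insert_subset hs hρ) (convex_closedBall c t)

theorem ballCap_subset_add_closedBall (he : ‖e‖ = 1) {s t η : ℝ} (hst : |s - t| ≤ η) :
    ballCap ρ e s ⊆ ballCap ρ e t + closedBall 0 η := by
  refine convexHull_min (Set.insert_subset ?_ fun x hx => ?_)
    ((convex_convexHull ℝ _).add (convex_closedBall 0 η))
  · refine ⟨t • e, smul_mem_ballCap t, (s - t) • e, ?_, ?_⟩
    · rwa [mem_closedBall_zero_iff, norm_smul, he, mul_one, Real.norm_eq_abs]
    · module
  · exact ⟨x, closedBall_subset_ballCap t hx, 0,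
      mem_closedBall_self ((abs_nonneg _).trans hst), add_zero x⟩

theorem hausdorffDist_ballCap_le (he : ‖e‖ = 1) (s t : ℝ) :
    hausdorffDist (ballCap ρ e s) (ballCap ρ e t) ≤ |s - t| := by
  have aux : ∀ u v : ℝ, |u - v| ≤ |s - t| →
      ∀ x ∈ ballCap ρ e u, ∃ y ∈ ballCap ρ e v, dist x y ≤ |s - t| := by
    intro u v huv x hx
    obtain ⟨y, hy, z, hz, rfl⟩ := ballCap_subset_add_closedBall he huv hx
    exact ⟨y, hy, by simpa [dist_eq_norm] using hz⟩
  exact hausdorffDist_le_of_mem_dist (abs_nonneg _) (aux s t le_rfl)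
    (aux t s (abs_sub_comm t s).le)

theorem isAdmissible_ballCap {r : ℝ} (hρ : 0 ≤ ρ) (he : ‖e‖ = 1) :
    IsAdmissible r (2 * ρ) fun s : Set.Icc ρ r => ballCap ρ e s where
  continuous t₀ := by
    refine ⟨fun η hη => ⟨η, hη, fun t ht => ballCap_subset_add_closedBall he ?_⟩,
      fun η hη => ⟨η, hη, fun t ht => ballCap_subset_add_closedBall he ?_⟩⟩
    · exact ht.le
    · rw [abs_sub_comm]
      exact ht.le
  nonempty t := ⟨_, smul_mem_ballCap _⟩
  compact t := isCompact_ballCap hρ _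
  convex t := convex_convexHull ℝ _
  subset_ball t := by
    refine ⟨0, ballCap_subset_closedBall ?_
      (closedBall_subset_closedBall (t.2.1.trans t.2.2))⟩
    rw [mem_closedBall_zero_iff, norm_smul, he, mul_one, Real.norm_of_nonneg (hρ.trans t.2.1)]
    exact t.2.2
  le_diam t := by
    have hmem : ∀ u : ℝ, |u| = ρ → u • e ∈ ballCap ρ e (t : ℝ) := fun u hu =>
      closedBall_subset_ballCap _ (by
        rw [mem_closedBall_zero_iff, norm_smul, he, mul_one, Real.norm_eq_abs, hu])
    have h := dist_le_diam_of_mem (isCompact_ballCap (e := e) hρ (t : ℝ)).isBounded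
      (hmem ρ (abs_of_nonneg hρ)) (hmem (-ρ) (by rw [abs_neg, abs_of_nonneg hρ]))
    have h2 : ρ • e - (-ρ) • e = (2 * ρ) • e := by module
    rwa [dist_eq_norm, h2, norm_smul, he, mul_one, Real.norm_of_nonneg (by positivity)] at h

/-- The support points of the strongly convex hulls of the ball and of the ball with a cap of
height `s - ρ` differ, in a suitable direction, by at least a multiple of `√(s - ρ)`. -/
theorem exists_argmaxSet_ballCap {R s : ℝ} {e' : EuclideanSpace ℝ (Fin n)} (hρ : 0 < ρ)
    (hs : ρ ≤ s) (hsR : s + 1 ≤ R) (he : ‖e‖ = 1) (he' : ‖e'‖ = 1) (hee' : inner ℝ e e' = 0) :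
    ∃ p x y : EuclideanSpace ℝ (Fin n), ‖p‖ = 1 ∧
      x ∈ argmaxSet p (stronglyConvexHull R (ballCap ρ e ρ)) ∧
      y ∈ argmaxSet p (stronglyConvexHull R (ballCap ρ e s)) ∧
      √(2 * ρ / R) * √(s - ρ) ≤ ‖x - y‖ := by
  have hs0 : 0 < s := hρ.trans_le hs
  have hR0 : 0 < R := by linarith
  -- `k = (e, p)` solves `‖s e - R p‖ = R - ρ`: the `R`-ball touching at the tip `s e` with normal
  -- `p` is internally tangent to the `ρ`-ball.
  obtain ⟨k, hk⟩ : ∃ k, k = (s ^ 2 - ρ ^ 2 + 2 * R * ρ) / (2 * R * s) := ⟨_, rfl⟩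
  have hk' : 2 * R * s * k = s ^ 2 - ρ ^ 2 + 2 * R * ρ := by
    rw [hk]
    field_simp
  have hk0 : 0 ≤ k := by
    rw [hk]
    have : 0 ≤ s ^ 2 - ρ ^ 2 := by nlinarith
    positivity
  have hk1 : k ≤ 1 := by
    rw [hk, div_le_one (by positivity)]
    nlinarith
  have hkk : 0 ≤ 1 - k ^ 2 := by nlinarith
  set p := k • e + √(1 - k ^ 2) • e' with hpdef
  have hp : ‖p‖ = 1 := by
    have : ‖p‖ ^ 2 = 1 := by
      rw [hpdef, norm_add_sq_real, inner_smul_left, inner_smul_right, hee', norm_smul, norm_smul,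
        he, he', Real.norm_eq_abs, Real.norm_eq_abs, mul_one, mul_one, sq_abs, sq_abs,
        Real.sq_sqrt hkk]
      ring
    exact (pow_eq_one_iff_of_nonneg (norm_nonneg _) two_ne_zero).1 this
  have hep : inner ℝ e p = k := by
    rw [hpdef, inner_add_right, inner_smul_right, inner_smul_right, hee',
      real_inner_self_eq_norm_sq, he]
    ring
  have hball : ∀ c : EuclideanSpace ℝ (Fin n), ‖c‖ ≤ R - ρ →
      closedBall (0 : EuclideanSpace ℝ (Fin n)) ρ ⊆ closedBall c R := fun c hc =>
    closedBall_subset_closedBall' (by rw [dist_zero_left]; linarith)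
  have hρe : ρ • e ∈ closedBall (0 : EuclideanSpace ℝ (Fin n)) ρ := by
    rw [mem_closedBall_zero_iff, norm_smul, he, mul_one, Real.norm_of_nonneg hρ.le]
  have hb1 : closedBall (0 : EuclideanSpace ℝ (Fin n)) ρ ⊆ closedBall (ρ • p - R • p) R := by
    refine hball _ ?_
    rw [← sub_smul, norm_smul, hp, mul_one, Real.norm_eq_abs, abs_sub_comm,
      abs_of_nonneg (by linarith)]
  have hb2 : closedBall (0 : EuclideanSpace ℝ (Fin n)) ρ ⊆ closedBall (s • e - R • p) R := by
    refine hball _ (abs_le_of_sq_le_sq' ?_ (by linarith)).2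
    rw [norm_sub_sq_real, inner_smul_left, inner_smul_right, hep, norm_smul, norm_smul, he, hp,
      Real.norm_eq_abs, Real.norm_eq_abs, mul_one, mul_one, sq_abs, sq_abs, RCLike.conj_to_real]
    linarith
  refine ⟨p, ρ • p, s • e, hp, ?_, ?_, ?_⟩
  · refine mem_argmaxSet_stronglyConvexHull hp (closedBall_subset_ballCap _ ?_)
      (ballCap_subset_closedBall (hb1 hρe) hb1)
    rw [mem_closedBall_zero_iff, norm_smul, hp, mul_one, Real.norm_of_nonneg hρ.le]
  · refine mem_argmaxSet_stronglyConvexHull hp (smul_mem_ballCap s)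
      (ballCap_subset_closedBall ?_ hb2)
    rw [mem_closedBall, dist_eq_norm, sub_sub_cancel, norm_smul, hp, mul_one,
      Real.norm_of_nonneg hR0.le]
  · rw [← Real.sqrt_mul (by positivity)]
    refine Real.sqrt_le_iff.2 ⟨norm_nonneg _, ?_⟩
    rw [norm_sub_sq_real, inner_smul_left, inner_smul_right, real_inner_comm, hep, norm_smul,
      norm_smul, he, hp, Real.norm_eq_abs, Real.norm_eq_abs, mul_one, mul_one, sq_abs, sq_abs,
      RCLike.conj_to_real, div_mul_eq_mul_div, div_le_iff₀ hR0]
    -- The squared distance equals `(s² - ρ²)(1 - ρ / R)`, with `s + ρ ≥ 2ρ` and `R - ρ ≥ 1`.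
    have h1 : 0 ≤ (s - ρ) * (2 * R - s - ρ - 2) * ρ :=
      mul_nonneg (mul_nonneg (by linarith) (by linarith)) hρ.le
    have h2 : (ρ ^ 2 - 2 * (ρ * (s * k)) + s ^ 2) * R
        = ρ ^ 2 * R + s ^ 2 * R - ρ * (2 * R * s * k) := by ring
    rw [h2, hk']
    nlinarith [mul_nonneg hR0.le (sq_nonneg (s - ρ))]

end Sharpness

/-- No power greater than `1 / 2` dominates the square root near zero. -/
theorem Real.exists_mul_rpow_lt_mul_sqrt {α : ℝ} (hα : 1 / 2 < α) (C : ℝ) {c δ : ℝ} (hc : 0 < c)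
    (hδ : 0 < δ) : ∃ u, 0 < u ∧ u < δ ∧ C * u ^ α < c * √u := by
  have hα' : 0 < α - 1 / 2 := by linarith
  have hlim : Filter.Tendsto (fun u : ℝ => C * u ^ (α - 1 / 2)) (nhdsWithin 0 (Set.Ioi 0))
      (nhds (C * (0 : ℝ) ^ (α - 1 / 2))) :=
    ((Real.continuousAt_rpow_const 0 _ (Or.inr hα'.le)).tendsto.mono_left
      nhdsWithin_le_nhds).const_mul C
  rw [Real.zero_rpow hα'.ne', mul_zero] at hlim
  obtain ⟨u, hu, hu0, huδ⟩ := ((hlim.eventually_lt_const hc).and (Ioo_mem_nhdsGT hδ)).exists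
  refine ⟨u, hu0, huδ, ?_⟩
  have h1 : u ^ α = u ^ (α - 1 / 2) * √u := by
    rw [Real.sqrt_eq_rpow, ← Real.rpow_add hu0, sub_add_cancel]
  rw [h1, ← mul_assoc]
  exact mul_lt_mul_of_pos_right hu (Real.sqrt_pos.2 hu0)

/-! ### Assembly of the theorem -/

theorem theorem3 (ε r d : ℝ) (hε₀ : 0 < ε) (hε₁ : ε < 1) (hr : 0 < r) (hd : 0 < d) :
    (∃ C : ℝ, ∀ (n : ℕ) (T : Type*) [MetricSpace T] (F : T → Set (EuclideanSpace ℝ (Fin n))),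
      IsAdmissible r d F →
        (∀ t, F t ⊆ strongApprox ε r F t ∧
          IsCompact (strongApprox ε r F t) ∧ Convex ℝ (strongApprox ε r F t) ∧
          Metric.hausdorffDist (F t) (strongApprox ε r F t) ≤ ε) ∧
        ∃ f : T → EuclideanSpace ℝ (Fin n) → EuclideanSpace ℝ (Fin n),
          (∀ t p, ‖p‖ = 1 → argmaxSet p (strongApprox ε r F t) = {f t p}) ∧
          ∀ t₁ t₂ p, ‖p‖ = 1 →
            ‖f t₁ p - f t₂ p‖ ≤
              C * max (Real.sqrt (Metric.hausdorffDist (F t₁) (F t₂)))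
                (Metric.hausdorffDist (F t₁) (F t₂))) ∧
    (∀ n : ℕ, 2 ≤ n → d < 2 * r →
      ∃ (T : Type) (_ : MetricSpace T) (F : T → Set (EuclideanSpace ℝ (Fin n))),
        IsAdmissible r d F ∧
        ∀ α : ℝ, 1 / 2 < α → ∀ C δ : ℝ, 0 < δ →
          ∃ (t₁ t₂ : T) (p x₁ x₂ : EuclideanSpace ℝ (Fin n)), ‖p‖ = 1 ∧
            x₁ ∈ argmaxSet p (strongApprox ε r F t₁) ∧
            x₂ ∈ argmaxSet p (strongApprox ε r F t₂) ∧
            Metric.hausdorffDist (F t₁) (F t₂) < δ ∧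
            C * Metric.hausdorffDist (F t₁) (F t₂) ^ α < ‖x₁ - x₂‖) := by
  have hRr : r + 1 ≤ max (r ^ 2 / ε) (r + 1) := le_max_right _ _
  have hRε : r ^ 2 ≤ max (r ^ 2 / ε) (r + 1) * ε := (div_le_iff₀ hε₀).1 (le_max_left _ _)
  unfold strongApprox
  set R := max (r ^ 2 / ε) (r + 1)
  have hR0 : 0 < R := by linarith
  refine ⟨⟨√(2 * R * (4 * R + 1) + (4 * R + 1) ^ 2), fun n T _ F hF => ?_⟩, fun n hn hdr => ?_⟩
  · choose a ha using hF.subset_ball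
    have haR : ∀ t, F t ⊆ closedBall (a t) R := fun t =>
      (ha t).trans (closedBall_subset_closedBall (by linarith))
    refine ⟨fun t => ⟨subset_stronglyConvexHull, isCompact_stronglyConvexHull (haR t),
      convex_stronglyConvexHull, hausdorffDist_stronglyConvexHull_le hε₀ hε₁.le hr hRr hRε
        (hF.nonempty t) (hF.compact t) (hF.convex t) (ha t)⟩, ?_⟩
    have hex : ∀ t (p : EuclideanSpace ℝ (Fin n)), ∃ x, ‖p‖ = 1 →
        argmaxSet p (stronglyConvexHull R (F t)) = {x} := by
      intro t p
      by_cases hp : ‖p‖ = 1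
      · obtain ⟨x, hx⟩ :=
          exists_argmaxSet_stronglyConvexHull_eq_singleton hR0 (hF.nonempty t) (haR t) hp
        exact ⟨x, fun _ => hx⟩
      · exact ⟨0, fun h => absurd h hp⟩
    choose f hf using hex
    refine ⟨f, hf, fun t₁ t₂ p hp => ?_⟩
    exact norm_sub_le_of_mem_argmaxSet hr hRr (hF.compact t₁) (hF.compact t₂) (hF.nonempty t₁)
      (hF.nonempty t₂) (ha t₁) (ha t₂) hp (by rw [hf t₁ p hp]; rfl) (by rw [hf t₂ p hp]; rfl)
  · obtain ⟨e, e', he, he', hee'⟩ : ∃ e e' : EuclideanSpace ℝ (Fin n),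
        ‖e‖ = 1 ∧ ‖e'‖ = 1 ∧ inner ℝ e e' = 0 := by
      have ho := EuclideanSpace.orthonormal_single (𝕜 := ℝ) (ι := Fin n)
      exact ⟨_, _, ho.1 ⟨0, by omega⟩, ho.1 ⟨1, by omega⟩, ho.2 (by simp)⟩
    have hρ : 0 < d / 2 := by linarith
    have hadm := isAdmissible_ballCap (r := r) hρ.le he
    rw [mul_div_cancel₀ d two_ne_zero] at hadm
    refine ⟨Set.Icc (d / 2) r, inferInstance, _, hadm, fun α hα C δ hδ => ?_⟩
    -- `|C|` is used because the Hausdorff distance is only bounded above, by `u`; `u < r - d / 2`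
    -- keeps the height in `T`.
    obtain ⟨u, hu0, huδ, hu⟩ := Real.exists_mul_rpow_lt_mul_sqrt hα |C|
      (Real.sqrt_pos.2 (by positivity : 0 < 2 * (d / 2) / R))
      (lt_min hδ (by linarith : 0 < r - d / 2))
    rw [lt_min_iff] at huδ
    obtain ⟨p, x, y, hp, hx, hy, hxy⟩ := exists_argmaxSet_ballCap (R := R) (s := d / 2 + u) hρ
      (by linarith) (by linarith) he he' hee'
    rw [add_sub_cancel_left] at hxy
    have hdist : hausdorffDist (ballCap (d / 2) e (d / 2)) (ballCap (d / 2) e (d / 2 + u)) ≤ u := by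
      refine (hausdorffDist_ballCap_le he _ _).trans_eq ?_
      rw [sub_add_cancel_left, abs_neg, abs_of_pos hu0]
    refine ⟨⟨d / 2, le_rfl, by linarith⟩, ⟨d / 2 + u, by linarith, by linarith⟩, p, x, y, hp, hx,
      hy, hdist.trans_lt huδ.1, ?_⟩
    calc C * hausdorffDist (ballCap (d / 2) e (d / 2)) (ballCap (d / 2) e (d / 2 + u)) ^ α
        ≤ |C| * u ^ α := by
          gcongr
          · exact Real.rpow_nonneg hausdorffDist_nonneg α
          · exact le_abs_self C
          · exact hausdorffDist_nonneg
      _ < √(2 * (d / 2) / R) * √u := hu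
      _ ≤ ‖x - y‖ := hxy
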